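/- Let $0<l<\infty$ and $\theta\in\mathbb{C}$ with $|\theta|=1$. Let $\zeta_1=1$, $\zeta_2=\frac12(-1+i\sqrt3)$, $\zeta_3=\frac12(-1-i\sqrt3)$ and $$s_p(z)=\frac13\sum_{k=1}^3\frac1{\zeta_k^p}e^{z\zeta_k}\qquad(p=0,1,2).$$ Let $L_0(\theta)$ be the operator $L_0(\theta)y=iy'''$ in $L^2(0,l)$ with domain $$\{y\in W_2^3(0,l):\ y(0)=0,\ y'(l)=\theta y'(0),\ y(l)=0\},$$ and let $\Delta_\theta(0,\lambda)$ be the entire function $$\Delta_\theta(0,\lambda)=-\frac{1}{(i\lambda)^2}\left[\theta s_2(i\lambda l)+s_2(-i\lambda l)\right],\qquad \Delta_\theta(0,0)=-\frac{l^2}{2}(\theta+1).$$ Then the real zeros of $\Delta_\theta(0,\cdot)$ form a strictly increasing two-sided sequence $\{\lambda_n(0,\theta)\}_{n\in\mathbb{Z}}$, and the spectrum of $L_0(\theta)$ is $$\sigma(L_0(\theta))=\{\lambda_n^3(0,\theta):n\in\mathbb{Z}\}.$$ The spectrum is simple: every point of it is an eigenvalue with a one-dimensional eigenspace. For $\lambda=\lambda_n(0,\theta)$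 the eigenspace for $\lambda^3$ is spanned by the function $$\psi_n(0,\lambda,x)=\frac1{a_n(\lambda)}\left\{\frac{s_2(i\lambda x)}{(i\lambda)^2}\cdot\frac{s_1(i\lambda l)}{i\lambda}-\frac{s_1(i\lambda x)}{i\lambda}\cdot\frac{s_2(i\lambda l)}{(i\lambda)^2}\right\},$$ where the number $a_n(\lambda)>0$ is determined by $\|\psi_n(0,\lambda,\cdot)\|_{L^2(0,l)}=1$; for $\lambda=0$ (which is a zero of $\Delta_\theta(0,\cdot)$ only if $\theta=-1$) the quotients $s_1(i\lambda x)/(i\lambda)$ and $s_2(i\lambda x)/(i\lambda)^2$ are replaced by their limits $x$ and $x^2/2$, so that $\psi$ is a multiple of $x^2-lx$. Moreover $\psi_n(0,\lambda\zeta_2,x)=\psi_n(0,\lambda,x)$, where for complex $\lambda$ the function $\psi_n(0,\lambda,\cdot)$ is defined by the same formula, with $a_n(\lambda)\ge 0$ the $L^2(0,l)$-norm of the expression in braces (and $\psi_n(0,\lambda,\cdot)=0$ if that expression vanishes identically). -/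

import Mathlib

open MeasureTheory Set

noncomputable section

/-- The cube roots of unity `1`, `(-1 + i√3)/2`, `(-1 - i√3)/2`. -/
def zeta : Fin 3 → ℂ :=
  ![1, (-1 + Complex.I * (Real.sqrt 3 : ℝ)) / 2, (-1 - Complex.I * (Real.sqrt 3 : ℝ)) / 2]

/-- The generalized trigonometric functions `s_p(z) = (1/3) ∑ₖ ζₖ^(-p) exp(z ζₖ)`. -/
def trigS (p : ℕ) (z : ℂ) : ℂ :=
  (1 / 3) * ∑ k : Fin 3, (1 / zeta k ^ p) * Complex.exp (z * zeta k)

/-- The function `s₁(iλx) / (iλ)`, entire in `λ`; its value at `λ = 0` is `x`. -/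
def solOne (lam : ℂ) (x : ℝ) : ℂ :=
  if lam = 0 then (x : ℂ) else trigS 1 (Complex.I * lam * x) / (Complex.I * lam)

/-- The function `s₂(iλx) / (iλ)²`, entire in `λ`; its value at `λ = 0` is `x²/2`. -/
def solTwo (lam : ℂ) (x : ℝ) : ℂ :=
  if lam = 0 then (x : ℂ) ^ 2 / 2 else trigS 2 (Complex.I * lam * x) / (Complex.I * lam) ^ 2

/-- The characteristic function `Δ_θ(0, λ) = -(θ s₂(iλl) + s₂(-iλl)) / (iλ)²`, an entire function
of `λ`; its value at the removable singularity `λ = 0` is `-(l²/2)(θ + 1)`. -/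
def charFn (l : ℝ) (θ lam : ℂ) : ℂ :=
  if lam = 0 then -((l : ℂ) ^ 2 / 2) * (θ + 1)
  else -(1 / (Complex.I * lam) ^ 2) *
    (θ * trigS 2 (Complex.I * lam * l) + trigS 2 (-(Complex.I * lam * l)))

/-- `s₂(iλx)/(iλ)² · s₁(iλl)/(iλ) - s₁(iλx)/(iλ) · s₂(iλl)/(iλ)²`. -/
def eigenFnRaw (l : ℝ) (lam : ℂ) (x : ℝ) : ℂ :=
  solTwo lam x * solOne lam l - solOne lam x * solTwo lam l

/-- The normalizing number `a(λ)`: the `L²(0,l)` norm of the unnormalized function. -/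
def normConst (l : ℝ) (lam : ℂ) : ℝ :=
  Real.sqrt (∫ x in (0 : ℝ)..l, ‖eigenFnRaw l lam x‖ ^ 2)

/-- The normalized function `ψ(0, λ, x)`. -/
def eigenFn (l : ℝ) (lam : ℂ) (x : ℝ) : ℂ :=
  (1 / (normConst l lam : ℂ)) * eigenFnRaw l lam x

/-- The Hilbert space `L²(0, l)` of complex functions. -/
abbrev L2Interval (l : ℝ) : Type := Lp ℂ 2 (volume.restrict (Ioo (0 : ℝ) l))

/-- `y` belongs to the Sobolev space `W₂³(0, l)` (more precisely it is the `C²` representative on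
`[0, l]`), with derivatives `y' = y₁`, `y'' = y₂` on `[0, l]`, where `y₂` is absolutely continuous
with almost everywhere derivative `y''' = y₃ ∈ L²(0, l)`. -/
structure IsSobolevThree (l : ℝ) (y y₁ y₂ y₃ : ℝ → ℂ) : Prop where
  hasDeriv_zero : ∀ x ∈ Icc 0 l, HasDerivWithinAt y (y₁ x) (Icc 0 l) x
  hasDeriv_one : ∀ x ∈ Icc 0 l, HasDerivWithinAt y₁ (y₂ x) (Icc 0 l) x
  absCont : AbsolutelyContinuousOnInterval y₂ 0 l
  ae_hasDeriv : ∀ᵐ x ∂volume.restrict (Ioo (0 : ℝ) l), HasDerivAt y₂ (y₃ x) x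
  memLp : MemLp y₃ 2 (volume.restrict (Ioo (0 : ℝ) l))

/-- The graph of `L₀(θ)`: pairs `(y, i y''')` with `y ∈ W₂³(0, l)`, `y(0) = 0`,
`y'(l) = θ y'(0)`, `y(l) = 0`. -/
def opGraph (l : ℝ) (θ : ℂ) : Submodule ℂ (L2Interval l × L2Interval l) where
  carrier := {p | ∃ y y₁ y₂ y₃ : ℝ → ℂ, IsSobolevThree l y y₁ y₂ y₃ ∧
    y 0 = 0 ∧ y₁ l = θ * y₁ 0 ∧ y l = 0 ∧
    (p.1 : ℝ → ℂ) =ᵐ[volume.restrict (Ioo (0 : ℝ) l)] y ∧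
    (p.2 : ℝ → ℂ) =ᵐ[volume.restrict (Ioo (0 : ℝ) l)] fun x => Complex.I * y₃ x}
  zero_mem' := by
    refine ⟨0, 0, 0, 0, ⟨?_, ?_, ?_, ?_, ?_⟩, by simp, by simp, by simp, ?_, ?_⟩
    · intro x _; exact hasDerivWithinAt_const x _ (0 : ℂ)
    · intro x _; exact hasDerivWithinAt_const x _ (0 : ℂ)
    · simp [absolutelyContinuousOnInterval_iff]
      intro ε hε; exact ⟨1, one_pos, fun _ _ _ _ => hε⟩
    · exact Filter.Eventually.of_forall fun x => hasDerivAt_const x (0 : ℂ)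
    · exact MemLp.zero
    · exact Lp.coeFn_zero _ _ _
    · filter_upwards [Lp.coeFn_zero ℂ 2 (volume.restrict (Ioo (0 : ℝ) l))] with x hx
      simpa using hx
  add_mem' := by
    rintro ⟨p, p'⟩ ⟨q, q'⟩ ⟨y, y₁, y₂, y₃, hy, a, b, c, d, e⟩ ⟨z, z₁, z₂, z₃, hz, a', b', c', d', e'⟩
    refine ⟨y + z, y₁ + z₁, y₂ + z₂, y₃ + z₃, ⟨?_, ?_, ?_, ?_, ?_⟩, ?_, ?_, ?_, ?_, ?_⟩
    · intro x hx; exact (hy.hasDeriv_zero x hx).add (hz.hasDeriv_zero x hx)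
    · intro x hx; exact (hy.hasDeriv_one x hx).add (hz.hasDeriv_one x hx)
    · exact hy.absCont.add hz.absCont
    · filter_upwards [hy.ae_hasDeriv, hz.ae_hasDeriv] with x h h'
      exact h.add h'
    · exact hy.memLp.add hz.memLp
    · simp [a, a']
    · simp [b, b', mul_add]
    · simp [c, c']
    · filter_upwards [Lp.coeFn_add p q, d, d'] with x h h1 h2
      simp_all
    · filter_upwards [Lp.coeFn_add p' q', e, e'] with x h h1 h2
      simp_all [mul_add]
  smul_mem' := by
    rintro r ⟨p, p'⟩ ⟨y, y₁, y₂, y₃, hy, a, b, c, d, e⟩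
    refine ⟨r • y, r • y₁, r • y₂, r • y₃, ⟨?_, ?_, ?_, ?_, ?_⟩, ?_, ?_, ?_, ?_, ?_⟩
    · intro x hx; exact (hy.hasDeriv_zero x hx).const_smul r
    · intro x hx; exact (hy.hasDeriv_one x hx).const_smul r
    · exact hy.absCont.const_smul r
    · filter_upwards [hy.ae_hasDeriv] with x h
      exact h.const_smul r
    · exact hy.memLp.const_smul r
    · simp [a]
    · simp [b]; ring
    · simp [c]
    · filter_upwards [Lp.coeFn_smul r p, d] with x h h1
      simp_all
    · filter_upwards [Lp.coeFn_smul r p', e] with x h h1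
      simp_all
      ring

/-- The third derivative is determined by the class of `y`, so that `opGraph` is a graph. -/
theorem opGraph_functional {l : ℝ} (hl : 0 < l) (θ : ℂ)
    (p : L2Interval l × L2Interval l) (hp : p ∈ opGraph l θ) (h0 : p.1 = 0) : p.2 = 0 := by
  obtain ⟨y, y₁, y₂, y₃, hy, -, -, -, d, e⟩ := hp
  have hU : UniqueDiffOn ℝ (Icc 0 l) := uniqueDiffOn_Icc hl
  have hc : ContinuousOn y (Icc 0 l) := fun x hx => (hy.hasDeriv_zero x hx).continuousWithinAt
  have hy0 : ∀ x ∈ Icc 0 l, y x = 0 := by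
    have hae : y =ᵐ[volume.restrict (Ioo (0 : ℝ) l)] fun _ => (0 : ℂ) := by
      rw [h0] at d
      filter_upwards [d, Lp.coeFn_zero ℂ 2 (volume.restrict (Ioo (0 : ℝ) l))] with x h1 h2
      rw [← h1, h2]; rfl
    have hopen : EqOn y (fun _ => (0 : ℂ)) (Ioo 0 l) :=
      Measure.eqOn_open_of_ae_eq hae isOpen_Ioo (hc.mono Ioo_subset_Icc_self) continuousOn_const
    have := hopen.of_subset_closure hc continuousOn_const Ioo_subset_Icc_self
      (by rw [closure_Ioo hl.ne])
    exact fun x hx => this hx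
  have step : ∀ f g : ℝ → ℂ, (∀ x ∈ Icc 0 l, f x = 0) →
      (∀ x ∈ Icc 0 l, HasDerivWithinAt f (g x) (Icc 0 l) x) → ∀ x ∈ Icc 0 l, g x = 0 := by
    intro f g hf hg x hx
    have h1 : HasDerivWithinAt f 0 (Icc 0 l) x :=
      (hasDerivWithinAt_const x (Icc 0 l) (0 : ℂ)).congr hf (hf x hx)
    exact (hU x hx).eq_deriv _ (hg x hx) h1
  have hy2 := step _ _ (step _ _ hy0 hy.hasDeriv_zero) hy.hasDeriv_one
  have hy3 : ∀ᵐ x ∂volume.restrict (Ioo (0 : ℝ) l), y₃ x = 0 := by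
    filter_upwards [hy.ae_hasDeriv, ae_restrict_mem measurableSet_Ioo] with x h hx
    have h1 : HasDerivAt y₂ 0 x := (hasDerivAt_const x (0 : ℂ)).congr_of_eventuallyEq
      (by filter_upwards [Icc_mem_nhds hx.1 hx.2] with t ht using hy2 t ht)
    exact h.unique h1
  refine Lp.ext ?_
  filter_upwards [e, hy3, Lp.coeFn_zero ℂ 2 (volume.restrict (Ioo (0 : ℝ) l))] with x h1 h2 h3
  rw [h1, h2, h3]; simp

/-- The operator `L₀(θ) y = i y'''` in `L²(0, l)` with domain
`{y ∈ W₂³(0, l) : y(0) = 0, y'(l) = θ y'(0), y(l) = 0}`. -/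
def opL (l : ℝ) (θ : ℂ) : L2Interval l →ₗ.[ℂ] L2Interval l := (opGraph l θ).toLinearPMap

theorem opL_graph {l : ℝ} (hl : 0 < l) (θ : ℂ) : (opL l θ).graph = opGraph l θ :=
  Submodule.toLinearPMap_graph_eq _ (opGraph_functional hl θ)

/-- The spectrum of an unbounded operator `A`: the complement of the set of those `z` for which
`A - z` maps the domain bijectively onto the space with a bounded inverse `R`. -/
def unboundedSpectrum {H : Type*} [NormedAddCommGroup H] [NormedSpace ℂ H]
    (A : H →ₗ.[ℂ] H) : Set ℂ :=
  {z | ¬ ∃ R : H →L[ℂ] H,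
    (∀ f : H, ∃ h : R f ∈ A.domain, A ⟨R f, h⟩ - z • R f = f) ∧
    (∀ y : A.domain, R (A y - z • (y : H)) = y)}

/-- The eigenspace `{y ∈ D(A) : A y = μ y}` of an unbounded operator. -/
def unboundedEigenspace {H : Type*} [NormedAddCommGroup H] [NormedSpace ℂ H]
    (A : H →ₗ.[ℂ] H) (μ : ℂ) : Submodule ℂ H :=
  (LinearMap.ker (A.toFun - μ • A.domain.subtype)).map A.domain.subtype

end

/- Let `s₀, s₁, s₂` be the fundamental system of `y''' = (iλ)³ y`, normalized at `0`. On its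
solutions with `y(0) = 0` the two remaining boundary conditions form a `2 × 2` system with
determinant `-Δ_θ(0, λ)`. Hence `λ³` is an eigenvalue exactly when `Δ_θ(0, λ) = 0`, and otherwise
variation of parameters shows that `L₀(θ) - λ³` is onto. Lagrange's identity and `|θ| = 1` make
the operator symmetric, so its eigenvalues are real, and where `L₀(θ) - μ` and `L₀(θ) - μ̄` are
both onto the closed graph theorem bounds the resolvent; thus the spectrum consists of the cubes
of the zeros. On the real axis `Δ_θ(0, ·)` is, up to a nonvanishing factor, a real function whose
exponentially dominant part oscillates with growing amplitude in both directions; its zeros are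
isolated and unbounded on both sides. For real `λ` the numbers `s₁(iλl)/(iλ)` and `s₂(iλl)/(iλ)²`
do not vanish together, so the condition `y(l) = 0` leaves a one-dimensional space, and the
spectrum is simple. -/

section CubeRoots

lemma zeta_zero : zeta 0 = 1 := rfl

lemma zeta_one_quadratic : zeta 1 ^ 2 + zeta 1 + 1 = 0 := by
  have h3 : ((√3 : ℝ) : ℂ) ^ 2 = 3 := by
    rw [← Complex.ofReal_pow, Real.sq_sqrt (by norm_num)]; norm_num
  simp only [zeta, Matrix.cons_val_one, Matrix.cons_val_zero]
  linear_combination (1 / 4 : ℂ) * Complex.I ^ 2 * h3 + (3 / 4 : ℂ) * Complex.I_sq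

lemma zeta_two : zeta 2 = zeta 1 ^ 2 := by
  have h : zeta 2 = -1 - zeta 1 := by
    simp only [zeta, Matrix.cons_val, Matrix.cons_val_one, Matrix.cons_val_zero]; ring
  linear_combination h - zeta_one_quadratic

lemma zeta_one_pow_three : zeta 1 ^ 3 = 1 := by
  linear_combination (zeta 1 - 1) * zeta_one_quadratic

lemma zeta_one_re : (zeta 1).re = -1 / 2 := by simp [zeta]

lemma zeta_one_im : (zeta 1).im = √3 / 2 := by simp [zeta]

lemma zeta_two_re : (zeta 2).re = -1 / 2 := by simp [zeta]

lemma zeta_two_im : (zeta 2).im = -(√3 / 2) := by simp [zeta, neg_div]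

lemma zeta_pow_three (k : Fin 3) : zeta k ^ 3 = 1 := by
  fin_cases k
  · exact one_pow 3
  · exact zeta_one_pow_three
  · change zeta 2 ^ 3 = 1
    rw [zeta_two, pow_right_comm, zeta_one_pow_three, one_pow]

lemma zeta_ne_zero (k : Fin 3) : zeta k ≠ 0 := fun h => by
  simpa [h] using zeta_pow_three k

lemma zeta_add_one (k : Fin 3) : zeta (k + 1) = zeta k * zeta 1 := by
  fin_cases k
  · exact (one_mul _).symm
  · exact zeta_two.trans (sq _)
  · change zeta 0 = zeta 2 * zeta 1
    rw [zeta_two, ← pow_succ, zeta_one_pow_three, zeta_zero]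

lemma star_zeta (k : Fin 3) : star (zeta k) = zeta (-k) := by
  fin_cases k
  · exact star_one ℂ
  · change star (zeta 1) = zeta 2
    simp [zeta, sub_eq_add_neg]
  · change star (zeta 2) = zeta 1
    simp [zeta]

end CubeRoots

section TrigS

lemma trigS_mul_zeta_one (p : ℕ) (z : ℂ) : trigS p (z * zeta 1) = zeta 1 ^ p * trigS p z := by
  have h := zeta_ne_zero 1
  simp only [trigS, Finset.mul_sum, ← Equiv.sum_comp (Equiv.addRight (1 : Fin 3))
    fun k => zeta 1 ^ p * (1 / 3 * (1 / zeta k ^ p * Complex.exp (z * zeta k)))]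
  refine Finset.sum_congr rfl fun k _ => ?_
  rw [Equiv.coe_addRight, zeta_add_one, mul_assoc, mul_comm (zeta 1) (zeta k), mul_pow]
  field_simp

lemma star_trigS (p : ℕ) (z : ℂ) : star (trigS p z) = trigS p (star z) := by
  simp only [trigS, ← Equiv.sum_comp (Equiv.neg (Fin 3))
    fun k => 1 / zeta k ^ p * Complex.exp (star z * zeta k)]
  simp only [Equiv.neg_apply, ← star_zeta]
  simp [← Complex.exp_conj]

lemma hasDerivAt_trigS_succ (p : ℕ) (z : ℂ) : HasDerivAt (trigS (p + 1)) (trigS p z) z := by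
  refine (HasDerivAt.fun_sum fun k _ => ?_).const_mul (1 / 3 : ℂ)
  refine ((((hasDerivAt_id z).mul_const (zeta k)).cexp).const_mul _).congr_deriv ?_
  have := zeta_ne_zero k
  simp only [id, pow_succ]
  field_simp

lemma trigS_add_three (p : ℕ) : trigS (p + 3) = trigS p := by
  funext z
  simp only [trigS, pow_add, zeta_pow_three, mul_one]

lemma trigS_eq (p : ℕ) (z : ℂ) : trigS p z = (Complex.exp z
    + (zeta 1 ^ 2) ^ p * Complex.exp (z * zeta 1)
    + zeta 1 ^ p * Complex.exp (z * zeta 1 ^ 2)) / 3 := by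
  have h₁ : (zeta 1)⁻¹ = zeta 1 ^ 2 :=
    inv_eq_of_mul_eq_one_right (by linear_combination zeta_one_pow_three)
  have h₂ : (zeta 1 ^ 2)⁻¹ = zeta 1 := by rw [← h₁, inv_inv]
  simp only [trigS, Fin.sum_univ_three, zeta_zero, zeta_two, one_div, ← inv_pow, h₁, h₂,
    inv_one, one_pow, one_mul, mul_one]
  ring

lemma trigS_zero_zero : trigS 0 0 = 1 := by norm_num [trigS_eq]

lemma trigS_one_zero : trigS 1 0 = 0 := by
  simp only [trigS_eq, zero_mul, Complex.exp_zero]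
  linear_combination (1 / 3 : ℂ) * zeta_one_quadratic

lemma trigS_two_zero : trigS 2 0 = 0 := by
  simp only [trigS_eq, zero_mul, Complex.exp_zero]
  linear_combination (1 / 3 : ℂ) * (zeta_one_quadratic + zeta 1 * zeta_one_pow_three)

lemma exp_mul_exp_zeta_mul_exp_zeta_sq (z : ℂ) :
    Complex.exp z * Complex.exp (z * zeta 1) * Complex.exp (z * zeta 1 ^ 2) = 1 := by
  rw [← Complex.exp_add, ← Complex.exp_add, ← Complex.exp_zero]
  congr 1
  linear_combination z * zeta_one_quadratic

/- The products of two distinct exponentials `exp (zζⱼ)` are the `exp (-zζₖ)`, and the squares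
cancel. -/
lemma trigS_one_sq_sub (z : ℂ) : trigS 1 z ^ 2 - trigS 0 z * trigS 2 z = trigS 2 (-z) := by
  have h := exp_mul_exp_zeta_mul_exp_zeta_sq z
  simp only [trigS_eq, neg_mul, Complex.exp_neg]
  set A := Complex.exp z
  set B := Complex.exp (z * zeta 1)
  set C := Complex.exp (z * zeta 1 ^ 2)
  have hA : A⁻¹ = B * C := inv_eq_of_mul_eq_one_right (by linear_combination h)
  have hB : B⁻¹ = A * C := inv_eq_of_mul_eq_one_right (by linear_combination h)
  have hC : C⁻¹ = A * B := inv_eq_of_mul_eq_one_right (by linear_combination h)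
  rw [hA, hB, hC]
  linear_combination (-(A * B + A * C + B * C) / 9) * zeta_one_quadratic
    + (-zeta 1 / 9 * (A * B) - zeta 1 / 3 * (A * C) + (2 - zeta 1) / 9 * (B * C))
      * zeta_one_pow_three

end TrigS

section FundamentalSystem

/-- The function `s₀(iλx)`, which completes `solOne` and `solTwo` to a fundamental system of
`y''' = (iλ)³ y`. -/
noncomputable def solZero (lam : ℂ) (x : ℝ) : ℂ := trigS 0 (Complex.I * lam * x)

lemma I_mul_mul_solOne (lam : ℂ) (x : ℝ) :
    Complex.I * lam * solOne lam x = trigS 1 (Complex.I * lam * x) := by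
  by_cases h : lam = 0
  · simp [h, trigS_one_zero]
  · rw [solOne, if_neg h, mul_div_cancel₀ _ (mul_ne_zero Complex.I_ne_zero h)]

lemma I_mul_sq_mul_solTwo (lam : ℂ) (x : ℝ) :
    (Complex.I * lam) ^ 2 * solTwo lam x = trigS 2 (Complex.I * lam * x) := by
  by_cases h : lam = 0
  · simp [h, trigS_two_zero]
  · rw [solTwo, if_neg h, mul_div_cancel₀ _ (pow_ne_zero 2 (mul_ne_zero Complex.I_ne_zero h))]

lemma hasDerivAt_trigS_comp (p : ℕ) (lam : ℂ) (x : ℝ) :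
    HasDerivAt (fun x : ℝ => trigS (p + 1) (Complex.I * lam * x))
      (trigS p (Complex.I * lam * x) * (Complex.I * lam)) x := by
  have h : HasDerivAt (fun x : ℝ => Complex.I * lam * (x : ℂ)) (Complex.I * lam) x := by
    simpa using (Complex.ofRealCLM.hasDerivAt (x := x)).const_mul (Complex.I * lam)
  exact (hasDerivAt_trigS_succ p _).comp x h

lemma hasDerivAt_solTwo (lam : ℂ) (x : ℝ) : HasDerivAt (solTwo lam) (solOne lam x) x := by
  by_cases h : lam = 0
  · have h1 := ((Complex.ofRealCLM.hasDerivAt (x := x)).pow 2).div_const 2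
    simp only [funext fun x => show solTwo lam x = (x : ℂ) ^ 2 / 2 from if_pos h]
    exact h1.congr_deriv (by simp [solOne, h])
  · simp only [funext fun x => show solTwo lam x = _ from if_neg h]
    refine ((hasDerivAt_trigS_comp 1 lam x).div_const _).congr_deriv ?_
    rw [← I_mul_mul_solOne]
    field_simp

lemma hasDerivAt_solOne (lam : ℂ) (x : ℝ) : HasDerivAt (solOne lam) (solZero lam x) x := by
  by_cases h : lam = 0
  · simp only [funext fun x => show solOne lam x = x from if_pos h]
    exact (Complex.ofRealCLM.hasDerivAt (x := x)).congr_deriv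
      (by simp [solZero, h, trigS_zero_zero])
  · have hne := mul_ne_zero Complex.I_ne_zero h
    simp only [funext fun x => show solOne lam x = _ from if_neg h]
    exact ((hasDerivAt_trigS_comp 0 lam x).div_const _).congr_deriv
      (mul_div_cancel_right₀ _ hne)

lemma hasDerivAt_solZero (lam : ℂ) (x : ℝ) :
    HasDerivAt (solZero lam) ((Complex.I * lam) ^ 3 * solTwo lam x) x := by
  have h := hasDerivAt_trigS_comp 2 lam x
  simp only [trigS_add_three 0, Nat.reduceAdd] at h
  exact h.congr_deriv (by rw [← I_mul_sq_mul_solTwo]; ring)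

/-- The solution of `y''' = (iλ)³ y` with initial data `y(0) = a`, `y'(0) = b`, `y''(0) = c`. -/
noncomputable def odeSol (lam a b c : ℂ) (x : ℝ) : ℂ :=
  a * solZero lam x + b * solOne lam x + c * solTwo lam x

lemma odeSol_apply_zero (lam a b c : ℂ) : odeSol lam a b c 0 = a := by
  simp [odeSol, solZero, solOne, solTwo, trigS_zero_zero, trigS_one_zero, trigS_two_zero]

lemma hasDerivAt_odeSol (lam a b c : ℂ) (x : ℝ) :
    HasDerivAt (odeSol lam a b c) (odeSol lam b c ((Complex.I * lam) ^ 3 * a) x) x := by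
  have h := (((hasDerivAt_solZero lam x).const_mul a).add
    ((hasDerivAt_solOne lam x).const_mul b)).add ((hasDerivAt_solTwo lam x).const_mul c)
  exact h.congr_deriv (by rw [odeSol]; ring)

lemma continuous_odeSol (lam a b c : ℂ) : Continuous (odeSol lam a b c) :=
  continuous_iff_continuousAt.2 fun x => (hasDerivAt_odeSol lam a b c x).continuousAt

lemma eq_zero_of_eqOn_odeSol {l : ℝ} (hl : 0 < l) {lam a b c : ℂ}
    (h : EqOn (odeSol lam a b c) 0 (Ioo 0 l)) : a = 0 ∧ b = 0 ∧ c = 0 := by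
  have coeff {a b c : ℂ} (h : EqOn (odeSol lam a b c) 0 (Ioo 0 l)) : a = 0 := by
    have h0 : (0 : ℝ) ∈ closure (Ioo 0 l) := by
      rw [closure_Ioo hl.ne]; exact left_mem_Icc.2 hl.le
    simpa [odeSol_apply_zero] using
      h.closure (continuous_odeSol lam a b c) continuous_zero h0
  have deriv {a b c : ℂ} (h : EqOn (odeSol lam a b c) 0 (Ioo 0 l)) :
      EqOn (odeSol lam b c ((Complex.I * lam) ^ 3 * a)) 0 (Ioo 0 l) := fun x hx =>
    (hasDerivAt_odeSol lam a b c x).unique <| (hasDerivAt_const x 0).congr_of_eventuallyEq <|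
      h.eventuallyEq_of_mem (isOpen_Ioo.mem_nhds hx)
  exact ⟨coeff h, coeff (deriv h), coeff (deriv (deriv h))⟩

lemma solOne_mul_zeta_one (lam : ℂ) (x : ℝ) : solOne (lam * zeta 1) x = solOne lam x := by
  by_cases h : lam = 0
  · simp [h]
  · have hz := zeta_ne_zero 1
    have hI := Complex.I_ne_zero
    have e : Complex.I * (lam * zeta 1) * x = Complex.I * lam * x * zeta 1 := by ring
    simp only [solOne, if_neg h, if_neg (mul_ne_zero h hz), e, trigS_mul_zeta_one]
    field_simp

lemma solTwo_mul_zeta_one (lam : ℂ) (x : ℝ) : solTwo (lam * zeta 1) x = solTwo lam x := by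
  by_cases h : lam = 0
  · simp [h]
  · have hz := zeta_ne_zero 1
    have hI := Complex.I_ne_zero
    have e : Complex.I * (lam * zeta 1) * x = Complex.I * lam * x * zeta 1 := by ring
    simp only [solTwo, if_neg h, if_neg (mul_ne_zero h hz), e, trigS_mul_zeta_one]
    field_simp

lemma eigenFn_mul_zeta_one (l : ℝ) (lam : ℂ) (x : ℝ) :
    eigenFn l (lam * zeta 1) x = eigenFn l lam x := by
  simp only [eigenFn, normConst, eigenFnRaw, solOne_mul_zeta_one, solTwo_mul_zeta_one]

lemma charFn_eq_det (l : ℝ) (θ lam : ℂ) : charFn l θ lam =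
    solTwo lam l * (solZero lam l - θ) - solOne lam l ^ 2 := by
  by_cases h : lam = 0
  · simp only [charFn, h, ↓reduceIte, neg_mul, solTwo, solZero, mul_zero, zero_mul,
      trigS_zero_zero, solOne]
    ring
  · have hI := Complex.I_ne_zero
    simp only [solTwo, solOne, solZero, charFn, if_neg h, ← trigS_one_sq_sub]
    field_simp
    ring

lemma trigS_one_ne_trigS_two {t : ℝ} (ht : t ≠ 0) :
    trigS 1 (Complex.I * t) ≠ trigS 2 (Complex.I * t) := by
  intro h
  have hz : zeta 1 ^ 2 - zeta 1 ≠ 0 := fun h0 => by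
    have h1 : zeta 1 ≠ 1 := fun h1 => by
      have := zeta_one_re
      norm_num [h1] at this
    exact h1 (mul_left_cancel₀ (zeta_ne_zero 1) (by linear_combination h0))
  have hexp : Complex.exp (Complex.I * t * zeta 1) = Complex.exp (Complex.I * t * zeta 2) := by
    refine mul_left_cancel₀ hz ?_
    simp only [trigS_eq] at h
    rw [zeta_two]
    linear_combination 3 * h + zeta 1 * Complex.exp (Complex.I * t * zeta 1) * zeta_one_pow_three
  have hnorm : -(t * (√3 / 2)) = t * (√3 / 2) := by
    simpa [Complex.norm_exp, zeta_one_im, zeta_two_im] using congrArg norm hexp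
  exact mul_ne_zero ht (by positivity : √3 / 2 ≠ 0) (by linarith)

lemma solOne_ne_zero_or_solTwo_ne_zero (lam : ℝ) {x : ℝ} (hx : x ≠ 0) :
    solOne lam x ≠ 0 ∨ solTwo lam x ≠ 0 := by
  rw [← not_and_or]
  rintro ⟨h₁, h₂⟩
  rcases eq_or_ne lam 0 with rfl | hlam
  · exact hx (by simpa [solOne] using h₁)
  · refine trigS_one_ne_trigS_two (mul_ne_zero hlam hx) ?_
    have e₁ := I_mul_mul_solOne lam x
    have e₂ := I_mul_sq_mul_solTwo lam x
    push_cast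
    rw [← mul_assoc, ← e₁, ← e₂, h₁, h₂, mul_zero, mul_zero]

end FundamentalSystem

section Oscillation

open Filter

lemma frequently_cos_mul_sub_eq_one {ω : ℝ} (hω : 0 < ω) (β : ℝ) :
    ∃ᶠ t in atTop, Real.cos (ω * t - β) = 1 := by
  have ht : Tendsto (fun n : ℕ => (n * (2 * Real.pi) + β) / ω) atTop atTop :=
    (tendsto_atTop_add_const_right _ _
      (tendsto_natCast_atTop_atTop.atTop_mul_const Real.two_pi_pos)).atTop_div_const hω
  refine ht.frequently (Frequently.of_forall fun n => ?_)
  rw [mul_div_cancel₀ _ hω.ne', add_sub_cancel_right, Real.cos_nat_mul_two_pi]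

lemma frequently_pos_of_oscillation {F g : ℝ → ℝ} {ω C : ℝ} (hω : 0 < ω) (β : ℝ)
    (hg : Tendsto g atTop atTop)
    (h : ∀ᶠ t in atTop, |F t - g t * Real.cos (ω * t - β)| ≤ C) : ∃ᶠ t in atTop, 0 < F t := by
  refine ((frequently_cos_mul_sub_eq_one hω β).and_eventually
    (h.and (hg.eventually_gt_atTop C))).mono fun t ⟨hcos, hle, hgt⟩ => ?_
  rw [hcos, mul_one] at hle
  linarith [neg_le_of_abs_le hle]

lemma frequently_neg_of_oscillation {F g : ℝ → ℝ} {ω C : ℝ} (hω : 0 < ω) (β : ℝ)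
    (hg : Tendsto g atTop atTop)
    (h : ∀ᶠ t in atTop, |F t - g t * Real.cos (ω * t - β)| ≤ C) : ∃ᶠ t in atTop, F t < 0 := by
  suffices ∃ᶠ t in atTop, 0 < -F t by simpa using this
  refine frequently_pos_of_oscillation (C := C) hω (β + Real.pi) hg (h.mono fun t ht => ?_)
  rwa [← sub_sub, Real.cos_sub_pi, mul_neg, ← neg_add', abs_neg, ← sub_eq_add_neg]

lemma frequently_eq_zero_of_frequently_pos_neg {F : ℝ → ℝ} (hF : Continuous F)
    (hpos : ∃ᶠ t in atTop, 0 < F t) (hneg : ∃ᶠ t in atTop, F t < 0) :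
    ∃ᶠ t in atTop, F t = 0 := by
  refine frequently_atTop.2 fun M => ?_
  obtain ⟨s, hs, hFs⟩ := frequently_atTop.1 hpos M
  obtain ⟨t, ht, hFt⟩ := frequently_atTop.1 hneg M
  obtain ⟨r, hr, hFr⟩ := intermediate_value_uIcc hF.continuousOn
    (mem_uIcc_of_ge hFt.le hFs.le : (0 : ℝ) ∈ uIcc (F s) (F t))
  exact ⟨r, (le_inf hs ht).trans hr.1, hFr⟩

lemma exists_strictMono_int_range_eq {α : Type*} [LinearOrder α] [Nonempty α] {S : Set α}
    (hfin : ∀ a b, (Icc a b ∩ S).Finite) (hup : ¬BddAbove S) (hdown : ¬BddBelow S) :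
    ∃ u : ℤ → α, StrictMono u ∧ range u = S := by
  have above := not_bddAbove_iff.1 hup
  have below := not_bddBelow_iff.1 hdown
  let _ : LocallyFiniteOrder S := LocallyFiniteOrder.ofFiniteIcc fun a b =>
    Set.Finite.of_finite_image ((hfin a b).subset (by
      rintro _ ⟨x, hx, rfl⟩
      exact ⟨⟨hx.1, hx.2⟩, x.2⟩)) Subtype.val_injective.injOn
  have : NoMaxOrder S := ⟨fun a => (above a).elim fun x ⟨hx, h⟩ => ⟨⟨x, hx⟩, h⟩⟩
  have : NoMinOrder S := ⟨fun a => (below a).elim fun x ⟨hx, h⟩ => ⟨⟨x, hx⟩, h⟩⟩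
  have : Nonempty S := ‹Nonempty α›.elim fun a => (above a).elim fun x hx => ⟨⟨x, hx.1⟩⟩
  let _ : SuccOrder S := LinearLocallyFiniteOrder.succOrder S
  let _ : PredOrder S := LinearLocallyFiniteOrder.predOrder S
  let e : S ≃o ℤ := orderIsoIntOfLinearSuccPredArch
  refine ⟨fun n => e.symm n, fun m n h => e.symm.strictMono h, ?_⟩
  rw [range_comp' Subtype.val e.symm, e.symm.surjective.range_eq, image_univ, Subtype.range_coe]

lemma finite_inter_zeros_of_analyticOnNhd {𝕜 E : Type*} [NontriviallyNormedField 𝕜]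
    [ConnectedSpace 𝕜] [NormedAddCommGroup E] [NormedSpace 𝕜 E] {f : 𝕜 → E}
    (hf : AnalyticOnNhd 𝕜 f univ) {x : 𝕜} (hx : f x ≠ 0) {K : Set 𝕜} (hK : IsCompact K) :
    (K ∩ {x | f x = 0}).Finite :=
  (hK.finite_sdiff_of_mem_codiscreteWithin (Filter.codiscreteWithin_mono (subset_univ K)
    (hf.preimage_zero_mem_codiscrete hx))).subset fun _ ht => ⟨ht.1, fun h => h ht.2⟩

end Oscillation

section RealZeros

open Filter Real

lemma zeta_one_eq_exp : zeta 1 = Complex.exp ((2 * π / 3 : ℝ) * Complex.I) := by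
  rw [show 2 * π / 3 = π - π / 3 by ring, Complex.exp_mul_I, ← Complex.ofReal_cos,
    ← Complex.ofReal_sin, cos_pi_sub, sin_pi_sub, cos_pi_div_three, sin_pi_div_three]
  simp only [zeta, Matrix.cons_val_one, Matrix.cons_val_zero]
  push_cast
  ring

lemma re_exp_mul_exp (φ t : ℝ) (z : ℂ) :
    (Complex.exp (φ * Complex.I) * Complex.exp (Complex.I * t * z)).re =
      exp (-(t * z.im)) * cos (t * z.re + φ) := by
  rw [← Complex.exp_add, Complex.exp_re]
  simp [add_comm]

/-- The real function whose zeros are those of `θ s₂(it) + s₂(-it)` for `θ = e^{2iα}`: the real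
part of `3 e^{iα} s₂(it)`. -/
noncomputable def realChar (α t : ℝ) : ℝ :=
  cos (t + α) + exp (-(√3 / 2 * t)) * cos (1 / 2 * t - (α + 2 * π / 3))
    + exp (√3 / 2 * t) * cos (1 / 2 * t - (α - 2 * π / 3))

lemma re_exp_mul_trigS_two (α t : ℝ) :
    (3 * (Complex.exp (α * Complex.I) * trigS 2 (Complex.I * t))).re = realChar α t := by
  have h₁ : Complex.exp (α * Complex.I) * zeta 1
      = Complex.exp ((α + 2 * π / 3 : ℝ) * Complex.I) := by
    rw [zeta_one_eq_exp, ← Complex.exp_add]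
    push_cast
    ring_nf
  have h₂ : Complex.exp (α * Complex.I) * zeta 1 ^ 2
      = Complex.exp ((α - 2 * π / 3 : ℝ) * Complex.I) := by
    have : Complex.exp ((α - 2 * π / 3 : ℝ) * Complex.I) * zeta 1
      = Complex.exp (α * Complex.I) := by
      rw [zeta_one_eq_exp, ← Complex.exp_add]
      push_cast
      ring_nf
    linear_combination -zeta 1 ^ 2 * this
      + Complex.exp ((α - 2 * π / 3 : ℝ) * Complex.I) * zeta_one_pow_three
  have h : 3 * (Complex.exp (α * Complex.I) * trigS 2 (Complex.I * t)) =
      Complex.exp (α * Complex.I) * Complex.exp (Complex.I * t * 1)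
      + Complex.exp ((α + 2 * π / 3 : ℝ) * Complex.I) * Complex.exp (Complex.I * t * zeta 1)
      + Complex.exp ((α - 2 * π / 3 : ℝ) * Complex.I) * Complex.exp (Complex.I * t * zeta 2) := by
    rw [← h₁, ← h₂, zeta_two, trigS_eq, mul_one]
    linear_combination Complex.exp (α * Complex.I) * zeta 1 * Complex.exp (Complex.I * t * zeta 1)
      * zeta_one_pow_three
  have hcos (φ : ℝ) : cos (t * (-1 / 2) + φ) = cos (1 / 2 * t - φ) := by
    rw [← cos_neg]; ring_nf
  rw [h, Complex.add_re, Complex.add_re, re_exp_mul_exp, re_exp_mul_exp, re_exp_mul_exp,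
    zeta_one_re, zeta_one_im, zeta_two_re, zeta_two_im, hcos, hcos, realChar]
  simp [mul_comm]

lemma mul_trigS_two_add_trigS_two_neg (α t : ℝ) :
    Complex.exp (α * Complex.I) ^ 2 * trigS 2 (Complex.I * t) + trigS 2 (-(Complex.I * t)) =
      2 / 3 * Complex.exp (α * Complex.I) * realChar α t := by
  have hc : Complex.exp (α * Complex.I) * star (Complex.exp (α * Complex.I)) = 1 := by
    simp [← Complex.exp_conj, ← Complex.exp_add]
  have hs : star (trigS 2 (Complex.I * t)) = trigS 2 (-(Complex.I * t)) := by
    rw [star_trigS]; simp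
  rw [← re_exp_mul_trigS_two, Complex.re_eq_add_conj]
  simp only [starRingEnd_apply, star_mul', hs, star_ofNat]
  linear_combination -trigS 2 (-(Complex.I * t)) * hc

lemma realChar_neg (α t : ℝ) : realChar α (-t) = realChar (-α) t := by
  have e₀ : cos (-t + α) = cos (t + -α) := by rw [← cos_neg, neg_add, neg_neg]
  have e₁ : cos (1 / 2 * -t - (α + 2 * π / 3)) = cos (1 / 2 * t - (-α - 2 * π / 3)) := by
    rw [← cos_neg]; ring_nf
  have e₂ : cos (1 / 2 * -t - (α - 2 * π / 3)) = cos (1 / 2 * t - (-α + 2 * π / 3)) := by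
    rw [← cos_neg]; ring_nf
  rw [realChar, realChar, e₀, e₁, e₂]
  simp only [mul_neg, neg_neg]
  ring

lemma analyticOnNhd_realChar (α : ℝ) : AnalyticOnNhd ℝ (realChar α) univ := fun t _ => by
  unfold realChar
  fun_prop

lemma continuous_realChar (α : ℝ) : Continuous (realChar α) := by
  unfold realChar
  fun_prop

lemma abs_realChar_sub_le (α : ℝ) {t : ℝ} (ht : 0 ≤ t) :
    |realChar α t - exp (√3 / 2 * t) * cos (1 / 2 * t - (α - 2 * π / 3))| ≤ 2 := by
  rw [realChar, add_sub_cancel_right]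
  have h : |exp (-(√3 / 2 * t)) * cos (1 / 2 * t - (α + 2 * π / 3))| ≤ 1 := by
    rw [abs_mul, abs_exp]
    exact mul_le_one₀ (exp_le_one_iff.2 (by simp only [Left.neg_nonpos_iff]; positivity))
      (abs_nonneg _) (abs_cos_le_one _)
  exact (abs_add_le _ _).trans (by linarith [abs_cos_le_one (t + α)])

lemma tendsto_exp_sqrt_three_div_two_mul : Tendsto (fun t => exp (√3 / 2 * t)) atTop atTop :=
  tendsto_exp_atTop.comp (tendsto_id.const_mul_atTop (by positivity))

lemma frequently_realChar_pos (α : ℝ) : ∃ᶠ t in atTop, 0 < realChar α t :=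
  frequently_pos_of_oscillation one_half_pos _ tendsto_exp_sqrt_three_div_two_mul
    ((eventually_ge_atTop 0).mono fun _ => abs_realChar_sub_le α)

lemma frequently_realChar_neg (α : ℝ) : ∃ᶠ t in atTop, realChar α t < 0 :=
  frequently_neg_of_oscillation one_half_pos _ tendsto_exp_sqrt_three_div_two_mul
    ((eventually_ge_atTop 0).mono fun _ => abs_realChar_sub_le α)

lemma exists_realChar_eq_zero_gt (α M : ℝ) : ∃ t > M, realChar α t = 0 :=
  frequently_atTop'.1 (frequently_eq_zero_of_frequently_pos_neg (continuous_realChar α)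
    (frequently_realChar_pos α) (frequently_realChar_neg α)) M

lemma exists_realChar_eq_zero_lt (α M : ℝ) : ∃ t < M, realChar α t = 0 := by
  obtain ⟨t, ht, h⟩ := exists_realChar_eq_zero_gt (-α) (-M)
  exact ⟨-t, neg_lt.1 ht, by rw [realChar_neg, h]⟩

lemma charFn_exp_sq_eq_zero_iff {l α x : ℝ} (hx : x ≠ 0) :
    charFn l (Complex.exp (α * Complex.I) ^ 2) x = 0 ↔ realChar α (x * l) = 0 := by
  have e : Complex.I * (x : ℂ) * l = Complex.I * ((x * l : ℝ) : ℂ) := by push_cast; ring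
  rw [charFn, if_neg (by exact_mod_cast hx), e, mul_trigS_two_add_trigS_two_neg]
  simp [hx]

lemma finite_Icc_inter_charFn_zeros {l : ℝ} (hl : 0 < l) (α a b : ℝ) :
    (Icc a b ∩ {x : ℝ | charFn l (Complex.exp (α * Complex.I) ^ 2) x = 0}).Finite := by
  obtain ⟨t, ht⟩ := (frequently_realChar_pos α).exists
  have hana : AnalyticOnNhd ℝ (fun x => realChar α (x * l)) univ :=
    (analyticOnNhd_realChar α).comp (fun x _ => by fun_prop) (mapsTo_univ _ _)
  have hne : realChar α (t / l * l) ≠ 0 := by rw [div_mul_cancel₀ _ hl.ne']; exact ht.ne'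
  refine ((finite_inter_zeros_of_analyticOnNhd hana hne isCompact_Icc).union
    (finite_singleton 0)).subset fun x ⟨hx, h⟩ => or_iff_not_imp_right.2 fun hx0 => ⟨hx, ?_⟩
  exact (charFn_exp_sq_eq_zero_iff hx0).1 h

theorem exists_strictMono_range_eq_charFn_zeros {l : ℝ} (hl : 0 < l) {θ : ℂ} (hθ : ‖θ‖ = 1) :
    ∃ lam : ℤ → ℝ, StrictMono lam ∧ range lam = {x : ℝ | charFn l θ x = 0} := by
  obtain ⟨α, rfl⟩ : ∃ α : ℝ, Complex.exp (α * Complex.I) ^ 2 = θ := by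
    refine ⟨θ.arg / 2, ?_⟩
    rw [← Complex.exp_nat_mul]
    conv_rhs => rw [← Complex.norm_mul_exp_arg_mul_I θ, hθ]
    push_cast
    ring_nf
  have hzero {t : ℝ} (ht : t ≠ 0) (h : realChar α t = 0) :
      charFn l (Complex.exp (α * Complex.I) ^ 2) (t / l : ℝ) = 0 :=
    (charFn_exp_sq_eq_zero_iff (div_ne_zero ht hl.ne')).2 (by rwa [div_mul_cancel₀ _ hl.ne'])
  refine exists_strictMono_int_range_eq (finite_Icc_inter_charFn_zeros hl α)
    (not_bddAbove_iff.2 fun M => ?_) (not_bddBelow_iff.2 fun M => ?_)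
  · obtain ⟨t, ht, h⟩ := exists_realChar_eq_zero_gt α (max 0 (M * l))
    obtain ⟨ht₀, htM⟩ := max_lt_iff.1 ht
    exact ⟨t / l, hzero ht₀.ne' h, (lt_div_iff₀ hl).2 htM⟩
  · obtain ⟨t, ht, h⟩ := exists_realChar_eq_zero_lt α (min 0 (M * l))
    obtain ⟨ht₀, htM⟩ := lt_min_iff.1 ht
    exact ⟨t / l, hzero ht₀.ne h, (div_lt_iff₀ hl).2 htM⟩

end RealZeros

section AbsoluteContinuity

variable {E : Type*} [NormedAddCommGroup E] [NormedSpace ℝ E]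

lemma absolutelyContinuousOnInterval_of_dist_le {X Y : Type*} [PseudoMetricSpace X]
    [PseudoMetricSpace Y] {f : ℝ → X} {g : ℝ → Y} {a b : ℝ}
    (hg : AbsolutelyContinuousOnInterval g a b)
    (h : ∀ x ∈ uIcc a b, ∀ y ∈ uIcc a b, dist (f x) (f y) ≤ dist (g x) (g y)) :
    AbsolutelyContinuousOnInterval f a b := by
  rw [absolutelyContinuousOnInterval_iff] at hg ⊢
  intro ε hε
  obtain ⟨δ, hδ, H⟩ := hg ε hε
  refine ⟨δ, hδ, fun I hI hlt => (Finset.sum_le_sum fun i hi => ?_).trans_lt (H I hI hlt)⟩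
  exact h _ (hI.1 i hi).1 _ (hI.1 i hi).2

lemma absolutelyContinuousOnInterval_integral {g : ℝ → E} {a b c : ℝ} (hc : c ∈ uIcc a b)
    (hg : IntervalIntegrable g volume a b) :
    AbsolutelyContinuousOnInterval (fun x => ∫ t in c..x, g t) a b := by
  refine absolutelyContinuousOnInterval_of_dist_le
    (hg.norm.absolutelyContinuousOnInterval_intervalIntegral hc) fun x hx y hy => ?_
  have hsub {z : ℝ} (hz : z ∈ uIcc a b) : IntervalIntegrable g volume c z :=
    hg.mono_set (uIcc_subset_uIcc hc hz)
  rw [dist_eq_norm, Real.dist_eq,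
    intervalIntegral.integral_interval_sub_left (hsub hx) (hsub hy),
    intervalIntegral.integral_interval_sub_left (hsub hx).norm (hsub hy).norm]
  exact intervalIntegral.norm_integral_le_abs_integral_norm

lemma integral_eq_sub_of_absolutelyContinuousOnInterval [CompleteSpace E] {f g : ℝ → E} {a b : ℝ}
    (hab : a ≤ b) (hf : AbsolutelyContinuousOnInterval f a b)
    (hg : IntervalIntegrable g volume a b)
    (h : ∀ᵐ x ∂volume.restrict (Ioo a b), HasDerivAt f (g x) x) :
    ∫ x in a..b, g x = f b - f a := by
  have hac := hf.fun_sub (absolutelyContinuousOnInterval_integral left_mem_uIcc hg)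
  have hderiv : ∀ᵐ x, x ∈ uIcc a b → HasDerivAt (fun x => f x - ∫ t in a..x, g t) 0 x := by
    rw [restrict_Ioo_eq_restrict_Icc, ← uIcc_of_le hab, ae_restrict_iff' measurableSet_uIcc] at h
    filter_upwards [h, hg.ae_hasDerivAt_integral] with x h₁ h₂ hx
    exact ((h₁ hx).fun_sub (h₂ hx a left_mem_uIcc)).congr_deriv (sub_self _)
  obtain ⟨C, hC⟩ := hac.const_of_ae_hasDerivAt_zero hderiv
  have ha := hC a left_mem_uIcc
  have hb := hC b right_mem_uIcc
  rw [intervalIntegral.integral_same, sub_zero] at ha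
  rw [ha, ← hb, sub_sub_cancel]

lemma absolutelyContinuousOnInterval_of_hasDerivWithinAt {f g : ℝ → E} {a b : ℝ}
    (hf : ∀ x ∈ uIcc a b, HasDerivWithinAt f (g x) (uIcc a b) x)
    (hg : ContinuousOn g (uIcc a b)) : AbsolutelyContinuousOnInterval f a b := by
  obtain ⟨C, hC⟩ := isCompact_uIcc.exists_bound_of_continuousOn hg
  have hC0 : 0 ≤ C := (norm_nonneg _).trans (hC a left_mem_uIcc)
  have : LipschitzOnWith ⟨C, hC0⟩ f (uIcc a b) :=
    (convex_uIcc a b).lipschitzOnWith_of_nnnorm_hasDerivWithin_le hf hC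
  exact this.absolutelyContinuousOnInterval

end AbsoluteContinuity

section SobolevSpace

lemma memLp_of_continuousOn_Icc {E : Type*} [NormedAddCommGroup E] {f : ℝ → E} {a b : ℝ}
    (hf : ContinuousOn f (Icc a b)) (p : ENNReal) : MemLp f p (volume.restrict (Ioo a b)) := by
  obtain ⟨C, hC⟩ := isCompact_Icc.exists_bound_of_continuousOn hf
  refine MemLp.of_bound
    ((hf.mono Ioo_subset_Icc_self).aestronglyMeasurable measurableSet_Ioo) C ?_
  filter_upwards [ae_restrict_mem measurableSet_Ioo] with x hx using hC x (Ioo_subset_Icc_self hx)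

namespace IsSobolevThree

variable {l : ℝ} {y y₁ y₂ y₃ z z₁ z₂ z₃ : ℝ → ℂ}

lemma of_hasDerivAt (l : ℝ) (h : ∀ x, HasDerivAt y (y₁ x) x) (h₁ : ∀ x, HasDerivAt y₁ (y₂ x) x)
    (h₂ : ∀ x, HasDerivAt y₂ (y₃ x) x) (hc : Continuous y₃) : IsSobolevThree l y y₁ y₂ y₃ where
  hasDeriv_zero x _ := (h x).hasDerivWithinAt
  hasDeriv_one x _ := (h₁ x).hasDerivWithinAt
  absCont := absolutelyContinuousOnInterval_of_hasDerivWithinAt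
    (fun x _ => (h₂ x).hasDerivWithinAt) hc.continuousOn
  ae_hasDeriv := .of_forall h₂
  memLp := memLp_of_continuousOn_Icc hc.continuousOn 2

protected lemma odeSol (l : ℝ) (lam a b c : ℂ) :
    IsSobolevThree l (odeSol lam a b c) (odeSol lam b c ((Complex.I * lam) ^ 3 * a))
      (odeSol lam c ((Complex.I * lam) ^ 3 * a) ((Complex.I * lam) ^ 3 * b))
      (odeSol lam ((Complex.I * lam) ^ 3 * a) ((Complex.I * lam) ^ 3 * b)
        ((Complex.I * lam) ^ 3 * c)) :=
  of_hasDerivAt l (hasDerivAt_odeSol _ _ _ _) (hasDerivAt_odeSol _ _ _ _)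
    (hasDerivAt_odeSol _ _ _ _) (continuous_odeSol _ _ _ _)

lemma add (hy : IsSobolevThree l y y₁ y₂ y₃) (hz : IsSobolevThree l z z₁ z₂ z₃) :
    IsSobolevThree l (y + z) (y₁ + z₁) (y₂ + z₂) (y₃ + z₃) where
  hasDeriv_zero x hx := (hy.hasDeriv_zero x hx).add (hz.hasDeriv_zero x hx)
  hasDeriv_one x hx := (hy.hasDeriv_one x hx).add (hz.hasDeriv_one x hx)
  absCont := hy.absCont.add hz.absCont
  ae_hasDeriv := by
    filter_upwards [hy.ae_hasDeriv, hz.ae_hasDeriv] with x h h' using h.add h'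
  memLp := hy.memLp.add hz.memLp

protected lemma star (hy : IsSobolevThree l y y₁ y₂ y₃) :
    IsSobolevThree l (star y) (star y₁) (star y₂) (star y₃) where
  hasDeriv_zero x hx := (hy.hasDeriv_zero x hx).star
  hasDeriv_one x hx := (hy.hasDeriv_one x hx).star
  absCont := absolutelyContinuousOnInterval_of_dist_le hy.absCont fun _ _ _ _ =>
    (dist_star_star _ _).le
  ae_hasDeriv := hy.ae_hasDeriv.mono fun _ h => h.star
  memLp := hy.memLp.star

lemma mono (hy : IsSobolevThree l y y₁ y₂ y₃) {x : ℝ} (hx : x ∈ Icc 0 l) :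
    IsSobolevThree x y y₁ y₂ y₃ where
  hasDeriv_zero t ht := (hy.hasDeriv_zero t ⟨ht.1, ht.2.trans hx.2⟩).mono
    (Icc_subset_Icc_right hx.2)
  hasDeriv_one t ht := (hy.hasDeriv_one t ⟨ht.1, ht.2.trans hx.2⟩).mono
    (Icc_subset_Icc_right hx.2)
  absCont := hy.absCont.mono (uIcc_subset_uIcc_left (Icc_subset_uIcc hx))
  ae_hasDeriv := ae_restrict_of_ae_restrict_of_subset (Ioo_subset_Ioo_right hx.2) hy.ae_hasDeriv
  memLp := hy.memLp.mono_measure (Measure.restrict_mono (Ioo_subset_Ioo_right hx.2) le_rfl)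

lemma continuousOn_zero (hy : IsSobolevThree l y y₁ y₂ y₃) : ContinuousOn y (Icc 0 l) :=
  fun x hx => (hy.hasDeriv_zero x hx).continuousWithinAt

lemma continuousOn_one (hy : IsSobolevThree l y y₁ y₂ y₃) : ContinuousOn y₁ (Icc 0 l) :=
  fun x hx => (hy.hasDeriv_one x hx).continuousWithinAt

lemma eqOn_one (hl : 0 < l) (hy : IsSobolevThree l y y₁ y₂ y₃) (hz : IsSobolevThree l z z₁ z₂ z₃)
    (h : EqOn y z (Icc 0 l)) : EqOn y₁ z₁ (Icc 0 l) := fun x hx =>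
  (uniqueDiffOn_Icc hl x hx).eq_deriv _ (hy.hasDeriv_zero x hx)
    ((hz.hasDeriv_zero x hx).congr h (h hx))

lemma absCont_zero (hl : 0 ≤ l) (hy : IsSobolevThree l y y₁ y₂ y₃) :
    AbsolutelyContinuousOnInterval y 0 l := by
  have h := hy.hasDeriv_zero
  have h' := hy.continuousOn_one
  rw [← uIcc_of_le hl] at h h'
  exact absolutelyContinuousOnInterval_of_hasDerivWithinAt h h'

lemma absCont_one (hl : 0 ≤ l) (hy : IsSobolevThree l y y₁ y₂ y₃) :
    AbsolutelyContinuousOnInterval y₁ 0 l := by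
  have h := hy.hasDeriv_one
  rw [← uIcc_of_le hl] at h
  exact absolutelyContinuousOnInterval_of_hasDerivWithinAt h hy.absCont.continuousOn

lemma ae_hasDerivAt (hy : IsSobolevThree l y y₁ y₂ y₃) :
    ∀ᵐ x ∂volume.restrict (Ioo (0 : ℝ) l), HasDerivAt y (y₁ x) x ∧ HasDerivAt y₁ (y₂ x) x ∧
      HasDerivAt y₂ (y₃ x) x := by
  filter_upwards [hy.ae_hasDeriv, ae_restrict_mem measurableSet_Ioo] with x h hx
  have hx' := Icc_mem_nhds hx.1 hx.2
  exact ⟨(hy.hasDeriv_zero x (Ioo_subset_Icc_self hx)).hasDerivAt hx',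
    (hy.hasDeriv_one x (Ioo_subset_Icc_self hx)).hasDerivAt hx', h⟩

lemma intervalIntegrable_three (hl : 0 ≤ l) (hy : IsSobolevThree l y y₁ y₂ y₃) :
    IntervalIntegrable y₃ volume 0 l := by
  rw [intervalIntegrable_iff_integrableOn_Ioo_of_le hl]
  exact hy.memLp.integrable one_le_two

lemma lagrange_identity (hl : 0 ≤ l) (hy : IsSobolevThree l y y₁ y₂ y₃)
    (hz : IsSobolevThree l z z₁ z₂ z₃) :
    ∫ x in 0..l, (y₃ x * z x + y x * z₃ x) =
      (y₂ l * z l - y₁ l * z₁ l + y l * z₂ l) - (y₂ 0 * z 0 - y₁ 0 * z₁ 0 + y 0 * z₂ 0) := by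
  have hW := ((hy.absCont.fun_smul (hz.absCont_zero hl)).fun_sub
    ((hy.absCont_one hl).fun_smul (hz.absCont_one hl))).fun_add
    ((hy.absCont_zero hl).fun_smul hz.absCont)
  refine integral_eq_sub_of_absolutelyContinuousOnInterval hl hW
    (((hy.intervalIntegrable_three hl).mul_continuousOn ?_).add
      ((hz.intervalIntegrable_three hl).continuousOn_mul ?_)) ?_
  · rw [uIcc_of_le hl]; exact hz.continuousOn_zero
  · rw [uIcc_of_le hl]; exact hy.continuousOn_zero
  · filter_upwards [hy.ae_hasDerivAt, hz.ae_hasDerivAt] with x ⟨hy₀, hy₁, hy₂⟩ ⟨hz₀, hz₁, hz₂⟩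
    refine (((hy₂.mul hz₀).sub (hy₁.mul hz₁)).add (hy₀.mul hz₂)).congr_deriv ?_
    ring

lemma reflect_solTwo (l x : ℝ) (lam : ℂ) : IsSobolevThree l (fun t => solTwo lam (x - t))
    (fun t => -solOne lam (x - t)) (fun t => solZero lam (x - t))
    (fun t => -((Complex.I * lam) ^ 3 * solTwo lam (x - t))) := by
  have hcont : Continuous (solTwo lam) :=
    continuous_iff_continuousAt.2 fun t => (hasDerivAt_solTwo lam t).continuousAt
  refine of_hasDerivAt l (fun t => (hasDerivAt_solTwo lam (x - t)).comp_const_sub x t)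
    (fun t => ?_) (fun t => (hasDerivAt_solZero lam (x - t)).comp_const_sub x t)
    (by fun_prop)
  exact ((hasDerivAt_solOne lam (x - t)).comp_const_sub x t).fun_neg.congr_deriv (neg_neg _)

lemma eq_odeSol {lam : ℂ} (hy : IsSobolevThree l y y₁ y₂ y₃)
    (h : ∀ᵐ x ∂volume.restrict (Ioo (0 : ℝ) l), y₃ x = (Complex.I * lam) ^ 3 * y x) {x : ℝ}
    (hx : x ∈ Icc 0 l) : y x = odeSol lam (y 0) (y₁ 0) (y₂ 0) x := by
  have hzero : ∫ t in 0..x, (y₃ t * solTwo lam (x - t) +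
      y t * -((Complex.I * lam) ^ 3 * solTwo lam (x - t))) = 0 := by
    rw [intervalIntegral.integral_of_le hx.1, integral_Ioc_eq_integral_Ioo]
    refine integral_eq_zero_of_ae ?_
    filter_upwards [ae_restrict_of_ae_restrict_of_subset (Ioo_subset_Ioo_right hx.2) h] with t ht
    rw [ht, Pi.zero_apply]
    ring
  have hLagrange := (hy.mono hx).lagrange_identity hx.1 (reflect_solTwo x x lam)
  have h₀ : solZero lam 0 = 1 := by simpa [odeSol] using odeSol_apply_zero lam 1 0 0
  have h₁ : solOne lam 0 = 0 := by simpa [odeSol] using odeSol_apply_zero lam 0 1 0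
  have h₂ : solTwo lam 0 = 0 := by simpa [odeSol] using odeSol_apply_zero lam 0 0 1
  rw [hzero, sub_self, sub_zero, h₀, h₁, h₂] at hLagrange
  rw [odeSol]
  linear_combination -hLagrange

end IsSobolevThree

end SobolevSpace

section ParticularSolution

/-- The solution of `u' = k u + f` with `u(0) = 0`, given by the variation of constants. -/
noncomputable def expConv (k : ℂ) (f : ℝ → ℂ) (x : ℝ) : ℂ :=
  Complex.exp (k * x) * ∫ t in 0..x, Complex.exp (-(k * t)) * f t

variable {k : ℂ} {f : ℝ → ℂ}

lemma expConv_zero (k : ℂ) (f : ℝ → ℂ) : expConv k f 0 = 0 := by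
  rw [expConv, intervalIntegral.integral_same, mul_zero]

lemma hasDerivAt_exp_mul_ofReal (k : ℂ) (x : ℝ) :
    HasDerivAt (fun x : ℝ => Complex.exp (k * x)) (Complex.exp (k * x) * k) x := by
  simpa using ((Complex.ofRealCLM.hasDerivAt (x := x)).const_mul k).cexp

lemma hasDerivAt_expConv {x : ℝ}
    (h : HasDerivAt (fun x : ℝ => ∫ t in 0..x, Complex.exp (-(k * t)) * f t)
      (Complex.exp (-(k * x)) * f x) x) :
    HasDerivAt (expConv k f) (k * expConv k f x + f x) x := by
  refine ((hasDerivAt_exp_mul_ofReal k x).mul h).congr_deriv ?_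
  rw [expConv, Complex.exp_neg, mul_inv_cancel_left₀ (Complex.exp_ne_zero _)]
  ring

lemma hasDerivAt_expConv_of_continuous (k : ℂ) (hf : Continuous f) (x : ℝ) :
    HasDerivAt (expConv k f) (k * expConv k f x + f x) x := by
  have hc : Continuous fun t : ℝ => Complex.exp (-(k * t)) * f t := by fun_prop
  exact hasDerivAt_expConv (hc.integral_hasStrictDerivAt 0 x).hasDerivAt

lemma ae_hasDerivAt_expConv (k : ℂ) (hf : LocallyIntegrable f) :
    ∀ᵐ x, HasDerivAt (expConv k f) (k * expConv k f x + f x) x := by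
  have hint : LocallyIntegrable fun t : ℝ => Complex.exp (-(k * t)) * f t :=
    hf.continuous_mul (by fun_prop)
  filter_upwards [LocallyIntegrable.ae_hasDerivAt_integral hint] with x hx
  exact hasDerivAt_expConv (hx 0)

lemma absolutelyContinuousOnInterval_expConv (k : ℂ) (hf : LocallyIntegrable f) (b : ℝ) :
    AbsolutelyContinuousOnInterval (expConv k f) 0 b := by
  have hint : IntervalIntegrable (fun t : ℝ => Complex.exp (-(k * t)) * f t) volume 0 b :=
    ((hf.continuous_mul (by fun_prop)).integrableOn_isCompact isCompact_uIcc).intervalIntegrable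
  exact (absolutelyContinuousOnInterval_of_hasDerivWithinAt
    (fun x _ => (hasDerivAt_exp_mul_ofReal k x).hasDerivWithinAt) (by fun_prop)).smul
      (absolutelyContinuousOnInterval_integral left_mem_uIcc hint)

lemma continuous_expConv (k : ℂ) (hf : LocallyIntegrable f) : Continuous (expConv k f) := by
  have hint : LocallyIntegrable fun t : ℝ => Complex.exp (-(k * t)) * f t :=
    hf.continuous_mul (by fun_prop)
  have hprim := intervalIntegral.continuous_primitive
    (fun a b =>
      (hint.integrableOn_isCompact (isCompact_uIcc (a := a) (b := b))).intervalIntegrable) 0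
  unfold expConv
  fun_prop

/- The operator factors as `(D - k₀) (D - k₁) (D - k₂)`, so that three first order equations have
to be solved in succession. -/
lemma IsSobolevThree.exists_particular_of_roots {l : ℝ} (k₀ k₁ k₂ : ℂ)
    (hf : MemLp f 2 (volume.restrict (Ioo (0 : ℝ) l))) :
    ∃ y y₁ y₂ y₃ : ℝ → ℂ, IsSobolevThree l y y₁ y₂ y₃ ∧ y 0 = 0 ∧ y₁ 0 = 0 ∧
      ∀ x ∈ Ioo 0 l, y₃ x - (k₀ + k₁ + k₂) * y₂ x + (k₀ * k₁ + k₀ * k₂ + k₁ * k₂) * y₁ x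
        - k₀ * k₁ * k₂ * y x = f x := by
  let g := (Ioo 0 l).indicator f
  have hg : LocallyIntegrable g :=
    ((integrable_indicator_iff measurableSet_Ioo).2 (hf.integrable one_le_two)).locallyIntegrable
  let v₁ := expConv k₀ g
  let v₂ := expConv k₁ v₁
  let y := expConv k₂ v₂
  have hv₁ : Continuous v₁ := continuous_expConv _ hg
  have hv₂ : Continuous v₂ := continuous_expConv _ hv₁.locallyIntegrable
  have hy : Continuous y := continuous_expConv _ hv₂.locallyIntegrable
  have dv₂ (x : ℝ) : HasDerivAt v₂ (k₁ * v₂ x + v₁ x) x := hasDerivAt_expConv_of_continuous _ hv₁ x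
  have dy (x : ℝ) : HasDerivAt y (k₂ * y x + v₂ x) x := hasDerivAt_expConv_of_continuous _ hv₂ x
  have dy₁ (x : ℝ) : HasDerivAt (fun x => k₂ * y x + v₂ x)
      (k₂ ^ 2 * y x + (k₁ + k₂) * v₂ x + v₁ x) x :=
    (((dy x).const_mul k₂).add (dv₂ x)).congr_deriv (by ring)
  refine ⟨y, fun x => k₂ * y x + v₂ x, fun x => k₂ ^ 2 * y x + (k₁ + k₂) * v₂ x + v₁ x,
    fun x => (k₂ ^ 3 * y x + (k₂ ^ 2 + k₂ * k₁ + k₁ ^ 2) * v₂ x + (k₀ + k₁ + k₂) * v₁ x) + f x,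
    ⟨fun x _ => (dy x).hasDerivWithinAt, fun x _ => (dy₁ x).hasDerivWithinAt, ?_, ?_, ?_⟩,
    expConv_zero _ _, ?_, fun x _ => by ring⟩
  · have hac {k : ℂ} {w : ℝ → ℂ} (hw : LocallyIntegrable w) (c : ℂ) :
        AbsolutelyContinuousOnInterval (fun x => c * expConv k w x) 0 l :=
      (absolutelyContinuousOnInterval_expConv k hw l).const_smul c
    exact ((hac hv₂.locallyIntegrable _).fun_add (hac hv₁.locallyIntegrable _)).fun_add
      (absolutelyContinuousOnInterval_expConv _ hg l)
  · filter_upwards [ae_restrict_of_ae (ae_hasDerivAt_expConv k₀ hg),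
      ae_restrict_mem measurableSet_Ioo] with x dv₁ hx
    rw [show g x = f x from indicator_of_mem hx f] at dv₁
    exact ((((dy x).const_mul (k₂ ^ 2)).add ((dv₂ x).const_mul (k₁ + k₂))).add dv₁).congr_deriv
      (by ring)
  · have hc : Continuous fun x => k₂ ^ 3 * y x + (k₂ ^ 2 + k₂ * k₁ + k₁ ^ 2) * v₂ x +
        (k₀ + k₁ + k₂) * v₁ x := by fun_prop
    exact (memLp_of_continuousOn_Icc hc.continuousOn 2).add hf
  · simp only [y, v₂, expConv_zero, mul_zero, add_zero]

lemma IsSobolevThree.exists_particular {l : ℝ} (lam : ℂ)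
    (hf : MemLp f 2 (volume.restrict (Ioo (0 : ℝ) l))) :
    ∃ y y₁ y₂ y₃ : ℝ → ℂ, IsSobolevThree l y y₁ y₂ y₃ ∧ y 0 = 0 ∧ y₁ 0 = 0 ∧
      ∀ x ∈ Ioo 0 l, y₃ x = (Complex.I * lam) ^ 3 * y x + f x := by
  obtain ⟨y, y₁, y₂, y₃, hy, h₀, h₁, h₃⟩ := exists_particular_of_roots
    (Complex.I * lam) (Complex.I * lam * zeta 1) (Complex.I * lam * zeta 1 ^ 2) hf
  refine ⟨y, y₁, y₂, y₃, hy, h₀, h₁, fun x hx => ?_⟩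
  rw [← h₃ x hx]
  linear_combination ((Complex.I * lam) * y₂ x - (Complex.I * lam) ^ 2 * zeta 1 * y₁ x) *
    zeta_one_quadratic + (Complex.I * lam) ^ 3 * y x * zeta_one_pow_three

end ParticularSolution

section UnboundedOperator

variable {H : Type*} [NormedAddCommGroup H]

lemma mem_unboundedEigenspace [NormedSpace ℂ H] {A : H →ₗ.[ℂ] H} {μ : ℂ} {u : H} :
    u ∈ unboundedEigenspace A μ ↔ (u, μ • u) ∈ A.graph := by
  rw [unboundedEigenspace, LinearPMap.mem_graph_iff]
  constructor
  · rintro ⟨v, hv, rfl⟩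
    exact ⟨v, rfl, sub_eq_zero.1 hv⟩
  · rintro ⟨v, rfl, hv⟩
    exact ⟨v, sub_eq_zero.2 hv, rfl⟩

lemma mem_unboundedSpectrum_of_eigenspace_ne_bot [NormedSpace ℂ H] {A : H →ₗ.[ℂ] H} {μ : ℂ}
    (h : unboundedEigenspace A μ ≠ ⊥) : μ ∈ unboundedSpectrum A := by
  obtain ⟨u, hu, hu0⟩ := Submodule.exists_mem_ne_zero_of_ne_bot h
  rintro ⟨R, -, hR⟩
  obtain ⟨v, hv, rfl⟩ := hu
  refine hu0 ((hR v).symm.trans ?_)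
  rw [show A v - μ • (v : H) = 0 from hv, map_zero]

variable [InnerProductSpace ℂ H] {A : H →ₗ.[ℂ] H}

lemma inner_map_sub_smul (hA : A.IsFormalAdjoint A) (z : ℂ) (u v : A.domain) :
    inner ℂ (A u - z • (u : H)) (v : H) = inner ℂ (u : H) (A v - star z • (v : H)) := by
  rw [inner_sub_left, inner_sub_right, inner_smul_left, inner_smul_right, hA u v]
  rfl

lemma star_eq_self_of_eigenspace_ne_bot (hA : A.IsFormalAdjoint A) {μ : ℂ}
    (h : unboundedEigenspace A μ ≠ ⊥) : star μ = μ := by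
  obtain ⟨u, ⟨v, hv, rfl⟩, hu0⟩ := Submodule.exists_mem_ne_zero_of_ne_bot h
  have hAv : A v = μ • (v : H) := sub_eq_zero.1 hv
  have h := hA v v
  rw [hAv, inner_smul_left, inner_smul_right] at h
  exact mul_right_cancel₀ (inner_self_ne_zero.2 hu0) h

/- By symmetry the resolvent `R` at `z` satisfies `⟪R f, (A - z̄) v⟫ = ⟪f, v⟫`. As the vectors
`(A - z̄) v` fill the space, the graph of `R` is closed. -/
lemma notMem_unboundedSpectrum_of_surjective [CompleteSpace H] (hA : A.IsFormalAdjoint A) {z : ℂ}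
    (hz : Function.Surjective (A.toFun - z • A.domain.subtype))
    (hz' : Function.Surjective (A.toFun - star z • A.domain.subtype)) :
    z ∉ unboundedSpectrum A := by
  have hinj : Function.Injective (A.toFun - z • A.domain.subtype) := by
    refine (injective_iff_map_eq_zero _).2 fun u hu => Subtype.ext (ext_inner_right ℂ fun w => ?_)
    obtain ⟨v, rfl⟩ := hz' w
    refine (inner_map_sub_smul hA z u v).symm.trans ?_
    rw [show A u - z • (u : H) = 0 from hu, inner_zero_left, Submodule.coe_zero, inner_zero_left]
  let e := LinearEquiv.ofBijective _ ⟨hinj, hz⟩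
  let R : H →ₗ[ℂ] H := A.domain.subtype ∘ₗ e.symm.toLinearMap
  have hR (f : H) : A (e.symm f) - z • (e.symm f : H) = f := e.apply_symm_apply f
  have hadj (f : H) (v : A.domain) :
      inner ℂ (R f) (A v - star z • (v : H)) = inner ℂ f (v : H) := by
    conv_rhs => rw [← hR f]
    exact (inner_map_sub_smul hA z (e.symm f) v).symm
  have hcont : Continuous R := by
    refine R.continuous_of_seq_closed_graph fun f g h hf hRf => ext_inner_right ℂ fun w => ?_
    obtain ⟨v, rfl⟩ := hz' w
    have hlim := hf.inner (𝕜 := ℂ) (tendsto_const_nhds (x := (v : H)))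
    simp only [← hadj] at hlim
    exact tendsto_nhds_unique (hRf.inner tendsto_const_nhds) hlim
  exact fun h => h ⟨⟨R, hcont⟩, fun f => ⟨(e.symm f).2, hR f⟩,
    fun y => congrArg Subtype.val (e.symm_apply_apply y)⟩

end UnboundedOperator

section BoundaryValueProblem

open Matrix

variable {l : ℝ} {θ : ℂ}

lemma inner_eq_of_mem_opGraph (hl : 0 ≤ l) (hθ : ‖θ‖ = 1) {p q : L2Interval l × L2Interval l}
    (hp : p ∈ opGraph l θ) (hq : q ∈ opGraph l θ) : inner ℂ p.2 q.1 = inner ℂ p.1 q.2 := by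
  obtain ⟨y, y₁, y₂, y₃, hy, hy0, hy₁, hyl, hp₁, hp₂⟩ := hp
  obtain ⟨z, z₁, z₂, z₃, hz, hz0, hz₁, hzl, hq₁, hq₂⟩ := hq
  have hθ' : star θ * θ = 1 := by
    rw [Complex.star_def, Complex.conj_mul', hθ]
    norm_num
  have hLagrange : ∫ x in 0..l, ((star y₃) x * z x + (star y) x * z₃ x) = 0 := by
    rw [hy.star.lagrange_identity hl hz]
    simp only [Pi.star_apply, hy0, hy₁, hyl, hz0, hz₁, hzl, star_zero, star_mul']
    linear_combination -(star (y₁ 0) * z₁ 0) * hθ'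
  rw [intervalIntegral.integral_of_le hl, integral_Ioc_eq_integral_Ioo] at hLagrange
  rw [← sub_eq_zero, L2.inner_def, L2.inner_def,
    ← integral_sub (L2.integrable_inner _ _) (L2.integrable_inner _ _),
    ← mul_zero (-Complex.I), ← hLagrange, ← integral_const_mul]
  refine integral_congr_ae ?_
  filter_upwards [hp₁, hp₂, hq₁, hq₂] with x hx₁ hx₂ hx₃ hx₄
  simp only [hx₁, hx₂, hx₃, hx₄, RCLike.inner_apply, map_mul, Complex.conj_I, Pi.star_apply,
    Complex.star_def]
  ring

lemma opL_isFormalAdjoint_self (hl : 0 < l) (hθ : ‖θ‖ = 1) :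
    (opL l θ).IsFormalAdjoint (opL l θ) := by
  have hgraph (u : (opL l θ).domain) : ((u : L2Interval l), opL l θ u) ∈ opGraph l θ :=
    opL_graph hl θ ▸ (opL l θ).mem_graph u
  exact fun u v => inner_eq_of_mem_opGraph hl.le hθ (hgraph u) (hgraph v)

/-- The matrix of the boundary forms `y(l)` and `y'(l) - θ y'(0)` on the solutions
`b s₁(iλx)/(iλ) + c s₂(iλx)/(iλ)²` of `y''' = (iλ)³ y`, `y(0) = 0`. -/
noncomputable def boundaryMatrix (l : ℝ) (θ lam : ℂ) : Matrix (Fin 2) (Fin 2) ℂ :=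
  !![solOne lam l, solTwo lam l; solZero lam l - θ, solOne lam l]

lemma det_boundaryMatrix (l : ℝ) (θ lam : ℂ) : (boundaryMatrix l θ lam).det = -charFn l θ lam := by
  rw [boundaryMatrix, det_fin_two_of, charFn_eq_det]
  ring

lemma boundaryMatrix_mulVec (l : ℝ) (θ lam : ℂ) (v : Fin 2 → ℂ) :
    boundaryMatrix l θ lam *ᵥ v =
      ![odeSol lam 0 (v 0) (v 1) l, odeSol lam (v 0) (v 1) 0 l - θ * v 0] := by
  simp only [boundaryMatrix, mulVec_eq_sum, odeSol]
  ext i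
  fin_cases i <;> simp [mul_comm, sub_mul, sub_add_eq_add_sub]

lemma memLp_odeSol (l : ℝ) (lam a b c : ℂ) :
    MemLp (odeSol lam a b c) 2 (volume.restrict (Ioo (0 : ℝ) l)) :=
  memLp_of_continuousOn_Icc (continuous_odeSol lam a b c).continuousOn 2

/-- `odeSol` as an element of `L²(0, l)`. -/
noncomputable def odeSolLp (l : ℝ) (lam a b c : ℂ) : L2Interval l := (memLp_odeSol l lam a b c).toLp

lemma smul_odeSolLp (l : ℝ) (lam a b c k : ℂ) :
    k • odeSolLp l lam a b c = odeSolLp l lam (k * a) (k * b) (k * c) := by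
  rw [odeSolLp, ← MemLp.toLp_const_smul]
  congr 1
  ext x
  simp only [Pi.smul_apply, odeSol, smul_eq_mul]
  ring

lemma eq_zero_of_odeSolLp_eq_zero (hl : 0 < l) {lam a b c : ℂ} (h : odeSolLp l lam a b c = 0) :
    a = 0 ∧ b = 0 ∧ c = 0 := by
  refine eq_zero_of_eqOn_odeSol hl (Measure.eqOn_open_of_ae_eq (μ := volume) ?_ isOpen_Ioo
    (continuous_odeSol lam a b c).continuousOn continuousOn_const)
  have hae := (memLp_odeSol l lam a b c).coeFn_toLp.symm
  rw [← odeSolLp, h] at hae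
  exact hae.trans (Lp.coeFn_zero ℂ 2 (volume.restrict (Ioo (0 : ℝ) l)))

lemma mem_eigenspace_opL_iff (hl : 0 < l) {lam : ℂ} {u : L2Interval l} :
    u ∈ unboundedEigenspace (opL l θ) (lam ^ 3) ↔
      ∃ v, boundaryMatrix l θ lam *ᵥ v = 0 ∧ odeSolLp l lam 0 (v 0) (v 1) = u := by
  rw [mem_unboundedEigenspace, opL_graph hl]
  constructor
  · rintro ⟨y, y₁, y₂, y₃, hy, hy0, hy₁, hyl, hu, hu₃⟩
    have hode : ∀ᵐ x ∂volume.restrict (Ioo (0 : ℝ) l), y₃ x = (Complex.I * lam) ^ 3 * y x := by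
      filter_upwards [hu, hu₃, Lp.coeFn_smul (lam ^ 3) u] with x hx hx₃ hsmul
      rw [hsmul, Pi.smul_apply, hx, smul_eq_mul] at hx₃
      linear_combination Complex.I * hx₃ + (y₃ x - Complex.I * lam ^ 3 * y x) * Complex.I_sq
    have hsol : EqOn y (odeSol lam 0 (y₁ 0) (y₂ 0)) (Icc 0 l) := fun x hx =>
      hy0 ▸ hy.eq_odeSol hode hx
    have hl' := right_mem_Icc.2 hl.le
    have hsol₁ := hy.eqOn_one hl (IsSobolevThree.odeSol l lam 0 (y₁ 0) (y₂ 0)) hsol hl'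
    refine ⟨![y₁ 0, y₂ 0], ?_, Lp.ext ?_⟩
    · rw [mul_zero] at hsol₁
      rw [boundaryMatrix_mulVec]
      simp [← hsol₁, ← hsol hl', hy₁, hyl]
    · filter_upwards [hu, (memLp_odeSol l lam 0 (y₁ 0) (y₂ 0)).coeFn_toLp,
        ae_restrict_mem measurableSet_Ioo] with x hx hx' hmem
      exact hx'.trans ((hx.trans (hsol (Ioo_subset_Icc_self hmem))).symm)
  · rintro ⟨v, hv, rfl⟩
    rw [boundaryMatrix_mulVec] at hv
    have hv₀ : odeSol lam 0 (v 0) (v 1) l = 0 := congrFun hv 0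
    have hv₁ : odeSol lam (v 0) (v 1) 0 l - θ * v 0 = 0 := congrFun hv 1
    refine ⟨_, _, _, _, IsSobolevThree.odeSol l lam 0 (v 0) (v 1), odeSol_apply_zero _ _ _ _, ?_,
      hv₀, (memLp_odeSol l lam 0 (v 0) (v 1)).coeFn_toLp, ?_⟩
    · rw [mul_zero, odeSol_apply_zero, sub_eq_zero.1 hv₁]
    · rw [odeSolLp, ← MemLp.toLp_const_smul]
      filter_upwards [((memLp_odeSol l lam 0 (v 0) (v 1)).const_smul (lam ^ 3)).coeFn_toLp]
        with x hx
      rw [hx, Pi.smul_apply, smul_eq_mul, odeSol, odeSol]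
      linear_combination lam ^ 3 * (v 0 * solOne lam x + v 1 * solTwo lam x) *
        (1 - Complex.I ^ 2) * Complex.I_sq

lemma eigenspace_opL_ne_bot_iff (hl : 0 < l) {lam : ℂ} :
    unboundedEigenspace (opL l θ) (lam ^ 3) ≠ ⊥ ↔ charFn l θ lam = 0 := by
  rw [← neg_eq_zero, ← det_boundaryMatrix, ← exists_mulVec_eq_zero_iff, Submodule.ne_bot_iff]
  constructor
  · rintro ⟨u, hu, hu0⟩
    obtain ⟨v, hv, rfl⟩ := (mem_eigenspace_opL_iff hl).1 hu
    refine ⟨v, fun hv0 => hu0 ?_, hv⟩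
    rw [hv0]
    simpa using (smul_odeSolLp l lam 0 0 0 0).symm
  · rintro ⟨v, hv0, hv⟩
    refine ⟨_, (mem_eigenspace_opL_iff hl).2 ⟨v, hv, rfl⟩, fun h => hv0 ?_⟩
    obtain ⟨-, h₀, h₁⟩ := eq_zero_of_odeSolLp_eq_zero hl h
    ext i
    fin_cases i
    exacts [h₀, h₁]

lemma surjective_opL_sub (hl : 0 < l) {lam : ℂ} (h : charFn l θ lam ≠ 0) :
    Function.Surjective ((opL l θ).toFun - lam ^ 3 • (opL l θ).domain.subtype) := by
  intro f
  obtain ⟨y, y₁, y₂, y₃, hy, hy0, hy₁0, hy₃⟩ :=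
    IsSobolevThree.exists_particular lam ((Lp.memLp f).const_mul (-Complex.I))
  have hdet : IsUnit (boundaryMatrix l θ lam) := by
    rw [isUnit_iff_isUnit_det, det_boundaryMatrix]
    exact (neg_ne_zero.2 h).isUnit
  obtain ⟨v, hv⟩ := mulVec_surjective_iff_isUnit.2 hdet ![-y l, -y₁ l]
  rw [boundaryMatrix_mulVec] at hv
  have hv₀ : odeSol lam 0 (v 0) (v 1) l = -y l := congrFun hv 0
  have hv₁ : odeSol lam (v 0) (v 1) 0 l - θ * v 0 = -y₁ l := congrFun hv 1
  have hz := hy.add (IsSobolevThree.odeSol l lam 0 (v 0) (v 1))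
  have hmem := memLp_of_continuousOn_Icc hz.continuousOn_zero 2
  have hgraph : (hmem.toLp, f + lam ^ 3 • hmem.toLp) ∈ opGraph l θ := by
    refine ⟨_, _, _, _, hz, ?_, ?_, ?_, hmem.coeFn_toLp, ?_⟩
    · rw [Pi.add_apply, hy0, odeSol_apply_zero, add_zero]
    · simp only [Pi.add_apply, hy₁0, mul_zero, odeSol_apply_zero]
      linear_combination hv₁
    · rw [Pi.add_apply, hv₀, add_neg_cancel]
    · filter_upwards [Lp.coeFn_add f (lam ^ 3 • hmem.toLp), Lp.coeFn_smul (lam ^ 3) hmem.toLp,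
        hmem.coeFn_toLp, ae_restrict_mem measurableSet_Ioo] with x hadd hsmul hx hxl
      rw [hadd, Pi.add_apply, hsmul, Pi.smul_apply, hx, smul_eq_mul, Pi.add_apply, Pi.add_apply,
        hy₃ x hxl, odeSol, odeSol]
      linear_combination (f x + lam ^ 3 * (y x + v 0 * solOne lam x + v 1 * solTwo lam x) *
        (1 - Complex.I ^ 2)) * Complex.I_sq
  rw [← opL_graph hl] at hgraph
  obtain ⟨u, hu, hu'⟩ := (LinearPMap.mem_graph_iff _).1 hgraph
  refine ⟨u, ?_⟩
  change opL l θ u - lam ^ 3 • (u : L2Interval l) = f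
  rw [hu, hu', add_sub_cancel_right]

lemma pow_three_mem_spectrum_opL_iff (hl : 0 < l) (hθ : ‖θ‖ = 1) {lam : ℂ} :
    lam ^ 3 ∈ unboundedSpectrum (opL l θ) ↔ charFn l θ lam = 0 := by
  have hA := opL_isFormalAdjoint_self hl hθ
  refine ⟨?_, fun h => mem_unboundedSpectrum_of_eigenspace_ne_bot
    ((eigenspace_opL_ne_bot_iff hl).2 h)⟩
  contrapose
  intro h
  have hstar : charFn l θ (star lam) ≠ 0 := fun h' => h <| by
    have hne := (eigenspace_opL_ne_bot_iff hl).2 h'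
    have hself := star_eq_self_of_eigenspace_ne_bot hA hne
    rw [star_pow, star_star] at hself
    exact (eigenspace_opL_ne_bot_iff hl).1 (hself ▸ hne)
  refine notMem_unboundedSpectrum_of_surjective hA (surjective_opL_sub hl h) ?_
  rw [star_pow]
  exact surjective_opL_sub hl hstar

lemma exists_pow_eq_of_odd {n : ℕ} (hn : Odd n) (r : ℝ) : ∃ x : ℝ, x ^ n = r := by
  rcases le_total 0 r with h | h
  · exact ⟨_, Real.rpow_inv_natCast_pow h hn.pos.ne'⟩
  · refine ⟨-(-r) ^ ((n : ℝ)⁻¹), ?_⟩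
    rw [hn.neg_pow, Real.rpow_inv_natCast_pow (neg_nonneg.2 h) hn.pos.ne', neg_neg]

lemma exists_real_of_mem_spectrum_opL (hl : 0 < l) (hθ : ‖θ‖ = 1) {μ : ℂ}
    (h : μ ∈ unboundedSpectrum (opL l θ)) : ∃ x : ℝ, charFn l θ x = 0 ∧ (x : ℂ) ^ 3 = μ := by
  obtain ⟨lam, rfl⟩ := IsAlgClosed.exists_pow_nat_eq μ three_pos
  have hne := (eigenspace_opL_ne_bot_iff hl).2 ((pow_three_mem_spectrum_opL_iff hl hθ).1 h)
  obtain ⟨r, hr⟩ := Complex.conj_eq_iff_real.1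
    (star_eq_self_of_eigenspace_ne_bot (opL_isFormalAdjoint_self hl hθ) hne)
  obtain ⟨x, rfl⟩ : ∃ x : ℝ, x ^ 3 = r := exists_pow_eq_of_odd (by decide) r
  rw [hr, Complex.ofReal_pow] at h ⊢
  exact ⟨x, (pow_three_mem_spectrum_opL_iff hl hθ).1 h, rfl⟩

end BoundaryValueProblem

section Eigenfunctions

variable {l : ℝ}

lemma eigenFnRaw_eq_odeSol (l : ℝ) (lam : ℂ) :
    eigenFnRaw l lam = odeSol lam 0 (-solTwo lam l) (solOne lam l) := by
  ext x
  rw [eigenFnRaw, odeSol]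
  ring

lemma normConst_eq_norm (hl : 0 ≤ l) (lam : ℂ) :
    normConst l lam = ‖odeSolLp l lam 0 (-solTwo lam l) (solOne lam l)‖ := by
  rw [odeSolLp, Lp.norm_toLp, (memLp_odeSol _ _ _ _ _).eLpNorm_eq_integral_rpow_norm two_ne_zero
    ENNReal.ofNat_ne_top, ENNReal.toReal_ofReal (by positivity), normConst, Real.sqrt_eq_rpow,
    intervalIntegral.integral_of_le hl, integral_Ioc_eq_integral_Ioo, eigenFnRaw_eq_odeSol]
  simp

lemma normConst_pos (hl : 0 < l) (lam : ℝ) : 0 < normConst l lam := by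
  rw [normConst_eq_norm hl.le, norm_pos_iff]
  intro h
  obtain ⟨-, h₂, h₁⟩ := eq_zero_of_odeSolLp_eq_zero hl h
  exact (solOne_ne_zero_or_solTwo_ne_zero lam hl.ne').elim (· h₁) (· (neg_eq_zero.1 h₂))

/-- The normalized function `eigenFn` as an element of `L²(0, l)`. -/
noncomputable def eigenFnLp (l : ℝ) (lam : ℂ) : L2Interval l :=
  (1 / normConst l lam : ℂ) • odeSolLp l lam 0 (-solTwo lam l) (solOne lam l)

lemma coeFn_eigenFnLp (l : ℝ) (lam : ℂ) :
    eigenFnLp l lam =ᵐ[volume.restrict (Ioo (0 : ℝ) l)] eigenFn l lam := by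
  filter_upwards [Lp.coeFn_smul (1 / normConst l lam : ℂ)
      (odeSolLp l lam 0 (-solTwo lam l) (solOne lam l)),
    (memLp_odeSol l lam 0 (-solTwo lam l) (solOne lam l)).coeFn_toLp] with x hsmul hx
  rw [eigenFnLp, hsmul, Pi.smul_apply, odeSolLp, hx, ← eigenFnRaw_eq_odeSol, eigenFn, smul_eq_mul]

lemma norm_eigenFnLp (hl : 0 < l) (lam : ℝ) : ‖eigenFnLp l lam‖ = 1 := by
  have hpos := normConst_pos hl lam
  rw [eigenFnLp, norm_smul, ← normConst_eq_norm hl.le, norm_div, norm_one, Complex.norm_real,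
    Real.norm_of_nonneg hpos.le, one_div_mul_cancel hpos.ne']

open Matrix in
lemma boundaryMatrix_mulVec_eq_zero_iff (hl : 0 < l) {θ : ℂ} {lam : ℝ} (h : charFn l θ lam = 0)
    {v : Fin 2 → ℂ} : boundaryMatrix l θ lam *ᵥ v = 0 ↔
      ∃ k, k * -solTwo lam l = v 0 ∧ k * solOne lam l = v 1 := by
  rw [charFn_eq_det] at h
  simp only [boundaryMatrix, funext_iff, Fin.forall_fin_two, mulVec, dotProduct, Fin.sum_univ_two,
    of_apply, cons_val', cons_val_zero, cons_val_one, cons_val_fin_one, Pi.zero_apply]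
  constructor
  · rintro ⟨hv, -⟩
    by_cases h₁ : solOne lam l = 0
    · have h₂ := (solOne_ne_zero_or_solTwo_ne_zero lam hl.ne').resolve_left (· h₁)
      refine ⟨-v 0 / solTwo lam l, by field_simp, ?_⟩
      rw [h₁, mul_zero, eq_comm]
      simpa [h₁, h₂] using hv
    · refine ⟨v 1 / solOne lam l, ?_, div_mul_cancel₀ _ h₁⟩
      field_simp
      linear_combination -hv
  · rintro ⟨k, h₀, h₁⟩
    rw [← h₀, ← h₁]
    exact ⟨by ring, by linear_combination -k * h⟩

lemma eigenspace_opL_eq_span (hl : 0 < l) {θ : ℂ} {lam : ℝ} (h : charFn l θ lam = 0) :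
    unboundedEigenspace (opL l θ) ((lam : ℂ) ^ 3) = Submodule.span ℂ {eigenFnLp l lam} := by
  have hN : (1 / normConst l lam : ℂ) ≠ 0 :=
    one_div_ne_zero (Complex.ofReal_ne_zero.2 (normConst_pos hl lam).ne')
  rw [eigenFnLp, Submodule.span_singleton_smul_eq hN.isUnit]
  ext u
  simp only [mem_eigenspace_opL_iff hl, boundaryMatrix_mulVec_eq_zero_iff hl h,
    Submodule.mem_span_singleton, smul_odeSolLp, mul_zero]
  constructor
  · rintro ⟨v, ⟨k, h₀, h₁⟩, rfl⟩
    exact ⟨k, by rw [h₀, h₁]⟩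
  · rintro ⟨k, rfl⟩
    exact ⟨![_, _], ⟨k, rfl, rfl⟩, rfl⟩

end Eigenfunctions

theorem theorem1p2 (l : ℝ) (hl : 0 < l) (θ : ℂ) (hθ : ‖θ‖ = 1) :
    ∃ lam : ℤ → ℝ,
      StrictMono lam ∧
      Set.range lam = {x : ℝ | charFn l θ (x : ℂ) = 0} ∧
      unboundedSpectrum (opL l θ) = Set.range (fun n : ℤ => (lam n : ℂ) ^ 3) ∧
      (∀ μ ∈ unboundedSpectrum (opL l θ),
        Module.finrank ℂ (unboundedEigenspace (opL l θ) μ) = 1) ∧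
      (∀ n : ℤ,
        0 < normConst l (lam n : ℂ) ∧
        ∃ Ψ : L2Interval l,
          (Ψ : ℝ → ℂ) =ᵐ[MeasureTheory.volume.restrict (Set.Ioo (0 : ℝ) l)]
            eigenFn l (lam n : ℂ) ∧
          ‖Ψ‖ = 1 ∧
          unboundedEigenspace (opL l θ) ((lam n : ℂ) ^ 3) = Submodule.span ℂ {Ψ}) ∧
      (∀ (w : ℂ) (x : ℝ), eigenFn l (w * zeta 1) x = eigenFn l w x) := by
  obtain ⟨lam, hmono, hrange⟩ := exists_strictMono_range_eq_charFn_zeros hl hθ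
  have hzero (n : ℤ) : charFn l θ (lam n) = 0 := hrange.subset (mem_range_self n)
  have hspec : unboundedSpectrum (opL l θ) = range fun n : ℤ => (lam n : ℂ) ^ 3 := by
    ext μ
    constructor
    · intro hμ
      obtain ⟨x, hx, rfl⟩ := exists_real_of_mem_spectrum_opL hl hθ hμ
      obtain ⟨n, rfl⟩ := hrange.superset hx
      exact mem_range_self n
    · rintro ⟨n, rfl⟩
      exact (pow_three_mem_spectrum_opL_iff hl hθ).2 (hzero n)
  refine ⟨lam, hmono, hrange, hspec, ?_, fun n => ⟨normConst_pos hl _, eigenFnLp l (lam n),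
    coeFn_eigenFnLp l _, norm_eigenFnLp hl _, eigenspace_opL_eq_span hl (hzero n)⟩,
    eigenFn_mul_zeta_one l⟩
  rw [hspec]
  rintro _ ⟨n, rfl⟩
  rw [eigenspace_opL_eq_span hl (hzero n)]
  exact finrank_span_singleton (norm_ne_zero_iff.1 (norm_eigenFnLp hl _ ▸ one_ne_zero))
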